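/- All digraphs $G=(V,E)$ are finite, with $E\subseteq V\times V$ (no parallel edges), and $n=|V|$. A digraph is strongly connected if there is a directed path from every vertex to every vertex. Let $G=(V,E)$ be a strongly connected digraph. An edge $e\in E$ is a strong bridge of $G$ if $(V,E\setminus\{e\})$ is not strongly connected, and a vertex $w\in V$ is a strong articulation point of $G$ if the subgraph $G\setminus\{w\}$ obtained by deleting $w$ is not strongly connected. $G$ is $2$-edge-connected if it is strongly connected and has no strong bridge. For $T\subseteq V$, $G$ is $2$-$T$-connected if it is $2$-edge-connected and no vertex of $T$ is a strong articulation point of $G$. $G$ is minimal $2$-$T$-connected if it is $2$-$T$-connected but, for every $e\in E$, the subgraph $(V,E\setminus\{e\})$ is not $2$-$T$-connected. Then, for every $T\subseteq V$, every minimal $2$-$T$-connected digraph $G=(V,E)$ with $n$ vertices has at most $8n$ edges: $|E|\le 8n$. -/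

import Mathlib

/-!
Fix a root `s ∉ T`. Deleting fewer than `k` edges and vertices of `T` leaves every remaining vertex
reachable from `s` iff every bi-set with wall in `T` that avoids `s` has degree at least `k`. Since
the degree of bi-sets is submodular, the tight bi-sets around a vertex `v` are closed under
intersection, and in an edge-minimal digraph the least of them is entered by all edges with head
`v`. All in-degrees are then at most `k`, so there are at most `k * n` edges. Doing this for
`k = 2` both in `G` and in its reverse gives a 2-T-connected spanning subgraph with at most `4 * n`
edges. For arbitrary `T`, two distinct roots `s` and `r` serve for `T \ {s}` and `T \ {r}`, and the
union of the two subgraphs is 2-T-connected with at most `8 * n` edges.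
-/

namespace Digraph

/-- The set of edges `(u, v)` of a directed graph. -/
def edgeSet {V : Type*} (G : Digraph V) : Set (V × V) :=
  {e | G.Adj e.1 e.2}

/-- The spanning subgraph `(V, E \ {e})`. -/
def deleteEdge {V : Type*} (G : Digraph V) (e : V × V) : Digraph V where
  Adj u v := G.Adj u v ∧ (u, v) ≠ e

/-- The subgraph `G \ {w}`, induced on the vertices different from `w`. -/
def deleteVertex {V : Type*} (G : Digraph V) (w : V) : Digraph {v : V // v ≠ w} where
  Adj u v := G.Adj u v

/-- There is a directed path (possibly of length zero) from every vertex to every vertex. -/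
def StronglyConnected {V : Type*} (G : Digraph V) : Prop :=
  ∀ u v : V, Relation.ReflTransGen G.Adj u v

/-- `w` is a strong articulation point of the (strongly connected) graph `G`:
`G \ {w}` is not strongly connected. -/
def IsStrongArticulationPoint {V : Type*} (G : Digraph V) (w : V) : Prop :=
  ¬ (G.deleteVertex w).StronglyConnected

/-- `e` is a strong bridge of the (strongly connected) graph `G`: it is an edge, and
`(V, E \ {e})` is not strongly connected. -/
def IsStrongBridge {V : Type*} (G : Digraph V) (e : V × V) : Prop :=
  e ∈ G.edgeSet ∧ ¬ (G.deleteEdge e).StronglyConnected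

/-- `G` is strongly connected and has no strong bridge. -/
def TwoEdgeConnected {V : Type*} (G : Digraph V) : Prop :=
  G.StronglyConnected ∧ ∀ e ∈ G.edgeSet, ¬ G.IsStrongBridge e

/-- `G` is 2-edge-connected and no vertex of `T` is a strong articulation point. -/
def TwoTConnected {V : Type*} (G : Digraph V) (T : Set V) : Prop :=
  G.TwoEdgeConnected ∧ ∀ w ∈ T, ¬ G.IsStrongArticulationPoint w

/-- `G` is 2-T-connected, and deleting any single edge destroys this. -/
def MinimalTwoTConnected {V : Type*} (G : Digraph V) (T : Set V) : Prop :=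
  G.TwoTConnected T ∧ ∀ e ∈ G.edgeSet, ¬ (G.deleteEdge e).TwoTConnected T

end Digraph

section

open Relation

variable {V : Type*} {G H : Digraph V} {T : Set V} {k : ℕ} {s : V}

section Residual

/-- The digraph left over from `G` after the failure of the edges in `F` and of the vertices in
`W`. The failed vertices are kept as isolated vertices, so that the vertex type does not change. -/
def residualDigraph (G : Digraph V) (F : Set (V × V)) (W : Set V) : Digraph V where
  Adj u v := G.Adj u v ∧ (u, v) ∉ F ∧ u ∉ W ∧ v ∉ W

/-- The digraph `G` with all its edges reversed, exchanging reachability from and to a vertex. -/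
def reverseDigraph (G : Digraph V) : Digraph V where
  Adj u v := G.Adj v u

theorem reflTransGen_adj_mono (hHG : H ≤ G) {u v : V} (h : ReflTransGen H.Adj u v) :
    ReflTransGen G.Adj u v :=
  ReflTransGen.mono (fun _ _ hab => hHG hab) u v h

theorem deleteEdge_le (G : Digraph V) (e : V × V) : G.deleteEdge e ≤ G :=
  fun _ _ hab => hab.1

theorem not_le_deleteEdge {e : V × V} (he : e ∈ G.edgeSet) : ¬ G ≤ G.deleteEdge e :=
  fun hle => (hle he).2 rfl

theorem residualDigraph_mono (hHG : H ≤ G) (F : Set (V × V)) (W : Set V) :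
    residualDigraph H F W ≤ residualDigraph G F W :=
  fun _ _ hab => ⟨hHG hab.1, hab.2⟩

theorem residualDigraph_reverseDigraph (G : Digraph V) (F : Set (V × V)) (W : Set V) :
    residualDigraph (reverseDigraph G) F W =
      reverseDigraph (residualDigraph G (Prod.swap ⁻¹' F) W) := by
  ext u v
  simp only [residualDigraph, reverseDigraph, Set.mem_preimage, Prod.swap_prod_mk]
  tauto

theorem reverseDigraph_le_iff : reverseDigraph H ≤ G ↔ H ≤ reverseDigraph G :=
  ⟨fun h _ _ hab => h hab, fun h _ _ hab => h hab⟩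

theorem ncard_edgeSet_sup_le (G H : Digraph V) :
    (G ⊔ H).edgeSet.ncard ≤ G.edgeSet.ncard + H.edgeSet.ncard :=
  Set.ncard_union_le G.edgeSet H.edgeSet

theorem ncard_preimage_swap {α β : Type*} (S : Set (α × β)) :
    (Prod.swap ⁻¹' S).ncard = S.ncard :=
  Set.ncard_preimage_of_injective_subset_range Prod.swap_injective
    (by simp [Prod.swap_surjective.range_eq])

theorem ncard_edgeSet_reverseDigraph (G : Digraph V) :
    (reverseDigraph G).edgeSet.ncard = G.edgeSet.ncard :=
  ncard_preimage_swap G.edgeSet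

end Residual

section RootConnected

/-- Rooted connectivity: as long as fewer than `k` edges and vertices of `T \ {s}` fail altogether,
`s` still reaches every remaining vertex. Since `Set.ncard` is `0` on infinite sets, this is meant
for finite `V`. -/
def RootConnected (k : ℕ) (s : V) (T : Set V) (G : Digraph V) : Prop :=
  ∀ (F : Set (V × V)) (W : Set V), W ⊆ T → s ∉ W → F.ncard + W.ncard < k →
    ∀ v ∉ W, ReflTransGen (residualDigraph G F W).Adj s v

theorem RootConnected.mono (h : RootConnected k s T H) (hHG : H ≤ G) : RootConnected k s T G :=
  fun F W hW hs hFW v hv =>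
    reflTransGen_adj_mono (residualDigraph_mono hHG F W) (h F W hW hs hFW v hv)

theorem rootConnected_reverseDigraph_iff :
    RootConnected k s T (reverseDigraph G) ↔
      ∀ (F : Set (V × V)) (W : Set V), W ⊆ T → s ∉ W → F.ncard + W.ncard < k →
        ∀ v ∉ W, ReflTransGen (residualDigraph G F W).Adj v s := by
  constructor
  · intro h F W hW hs hFW v hv
    have hrev := h (Prod.swap ⁻¹' F) W hW hs (by rwa [ncard_preimage_swap]) v hv
    rw [residualDigraph_reverseDigraph] at hrev
    exact hrev.swap
  · intro h F W hW hs hFW v hv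
    rw [residualDigraph_reverseDigraph]
    exact (h (Prod.swap ⁻¹' F) W hW hs (by rwa [ncard_preimage_swap]) v hv).swap

theorem forall_rootConnected_iff (hs : s ∉ T) :
    (∀ u, RootConnected k u T G) ↔
      RootConnected k s T G ∧ RootConnected k s T (reverseDigraph G) := by
  rw [rootConnected_reverseDigraph_iff]
  constructor
  · exact fun h => ⟨h s, fun F W hW hsW hFW v hv => h v F W hW hv hFW s hsW⟩
  · rintro ⟨hout, hin⟩ u F W hW hu hFW v hv
    have hsW : s ∉ W := fun hsW => hs (hW hsW)
    exact (hin F W hW hsW hFW u hu).trans (hout F W hW hsW hFW v hv)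

end RootConnected

section Bisets

/-- `B = (I, O)` is a bi-set with nonempty inner set `I` and outer set `O ⊇ I`, avoiding the root
`s` and with wall `O \ I` contained in `T`. Pairs are used so that bi-sets are intersected, united
and compared in the componentwise lattice `Set V × Set V`. -/
structure IsRootBiset (s : V) (T : Set V) (B : Set V × Set V) : Prop where
  inner_subset_outer : B.1 ⊆ B.2
  inner_nonempty : B.1.Nonempty
  root_notMem_outer : s ∉ B.2
  wall_subset : B.2 \ B.1 ⊆ T

/-- The edges entering the bi-set `B`: they lead from outside the outer set to the inner set. -/
def enteringEdges (G : Digraph V) (B : Set V × Set V) : Set (V × V) :=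
  {e ∈ G.edgeSet | e.1 ∉ B.2 ∧ e.2 ∈ B.1}

/-- The degree of a bi-set: the number of edges and wall vertices whose failure separates the inner
set from the complement of the outer set. -/
noncomputable def bisetDegree (G : Digraph V) (B : Set V × Set V) : ℕ :=
  (enteringEdges G B).ncard + (B.2 \ B.1).ncard

variable {B C : Set V × Set V}

theorem IsRootBiset.inf (hB : IsRootBiset s T B) (hC : IsRootBiset s T C)
    (hne : (B.1 ∩ C.1).Nonempty) : IsRootBiset s T (B ⊓ C) where
  inner_subset_outer := Set.inter_subset_inter hB.inner_subset_outer hC.inner_subset_outer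
  inner_nonempty := hne
  root_notMem_outer := fun hs => hB.root_notMem_outer hs.1
  wall_subset := by
    rintro x ⟨⟨hxB, hxC⟩, hx⟩
    by_cases hxI : x ∈ B.1
    · exact hC.wall_subset ⟨hxC, fun hxI' => hx ⟨hxI, hxI'⟩⟩
    · exact hB.wall_subset ⟨hxB, hxI⟩

theorem IsRootBiset.sup (hB : IsRootBiset s T B) (hC : IsRootBiset s T C) :
    IsRootBiset s T (B ⊔ C) where
  inner_subset_outer := Set.union_subset_union hB.inner_subset_outer hC.inner_subset_outer
  inner_nonempty := hB.inner_nonempty.mono Set.subset_union_left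
  root_notMem_outer := fun hs => hs.elim hB.root_notMem_outer hC.root_notMem_outer
  wall_subset := by
    rintro x ⟨hxB | hxC, hx⟩
    · exact hB.wall_subset ⟨hxB, fun hxI => hx (Or.inl hxI)⟩
    · exact hC.wall_subset ⟨hxC, fun hxI => hx (Or.inr hxI)⟩

theorem enteringEdges_deleteEdge (G : Digraph V) (e : V × V) (B : Set V × Set V) :
    enteringEdges (G.deleteEdge e) B = enteringEdges G B \ {e} := by
  ext f
  simp only [enteringEdges, Digraph.edgeSet, Digraph.deleteEdge, Set.mem_ofPred_eq, Set.mem_sdiff,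
    Set.mem_singleton_iff]
  tauto

theorem ncard_add_ncard_le_of_union_subset_of_inter_subset {α : Type*} [Finite α]
    {A A' X X' : Set α} (hunion : A ∪ A' ⊆ X ∪ X') (hinter : A ∩ A' ⊆ X ∩ X') :
    A.ncard + A'.ncard ≤ X.ncard + X'.ncard := by
  rw [← Set.ncard_union_add_ncard_inter A, ← Set.ncard_union_add_ncard_inter X]
  exact Nat.add_le_add (Set.ncard_le_ncard hunion) (Set.ncard_le_ncard hinter)

theorem bisetDegree_submodular [Finite V] (G : Digraph V) (B C : Set V × Set V) :
    bisetDegree G (B ⊓ C) + bisetDegree G (B ⊔ C) ≤ bisetDegree G B + bisetDegree G C := by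
  have hedges : (enteringEdges G (B ⊓ C)).ncard + (enteringEdges G (B ⊔ C)).ncard ≤
      (enteringEdges G B).ncard + (enteringEdges G C).ncard := by
    apply ncard_add_ncard_le_of_union_subset_of_inter_subset <;> intro e <;>
      simp only [enteringEdges, Prod.fst_inf, Prod.snd_inf, Prod.fst_sup, Prod.snd_sup,
        Set.inf_eq_inter, Set.sup_eq_union, Set.mem_union, Set.mem_inter_iff, Set.mem_ofPred_eq] <;>
      tauto
  have hwall : ((B ⊓ C).2 \ (B ⊓ C).1).ncard + ((B ⊔ C).2 \ (B ⊔ C).1).ncard ≤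
      (B.2 \ B.1).ncard + (C.2 \ C.1).ncard := by
    apply ncard_add_ncard_le_of_union_subset_of_inter_subset <;> intro x <;>
      simp only [Prod.fst_inf, Prod.snd_inf, Prod.fst_sup, Prod.snd_sup,
        Set.inf_eq_inter, Set.sup_eq_union, Set.mem_union, Set.mem_inter_iff, Set.mem_sdiff] <;>
      tauto
  unfold bisetDegree
  omega

theorem exists_rel_entering_of_reflTransGen {α : Type*} {r : α → α → Prop} {S : Set α} {a b : α}
    (h : ReflTransGen r a b) (ha : a ∉ S) (hb : b ∈ S) : ∃ x ∉ S, ∃ y ∈ S, r x y := by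
  induction h with
  | refl => exact absurd hb ha
  | @tail x y _ hxy ih =>
    by_cases hx : x ∈ S
    · exact ih hx
    · exact ⟨x, hx, y, hb, hxy⟩

theorem RootConnected.le_bisetDegree (h : RootConnected k s T G) (hB : IsRootBiset s T B) :
    k ≤ bisetDegree G B := by
  by_contra! hlt
  obtain ⟨v, hv⟩ := hB.inner_nonempty
  have hreach : ReflTransGen (residualDigraph G (enteringEdges G B) (B.2 \ B.1)).Adj s v :=
    h _ _ hB.wall_subset (fun hs => hB.root_notMem_outer hs.1) hlt v fun hv' => hv'.2 hv
  obtain ⟨x, hx, y, hy, hadj, hnotEntering, hxW, -⟩ := exists_rel_entering_of_reflTransGen hreach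
    (fun hs => hB.root_notMem_outer (hB.inner_subset_outer hs)) hv
  exact hnotEntering ⟨hadj, fun hxO => hxW ⟨hxO, hx⟩, hy⟩

theorem rootConnected_of_forall_le_bisetDegree [Finite V]
    (h : ∀ B, IsRootBiset s T B → k ≤ bisetDegree G B) : RootConnected k s T G := by
  intro F W hWT hsW hFW v hvW
  by_contra hv
  let I : Set V := {x | x ∉ W ∧ ¬ ReflTransGen (residualDigraph G F W).Adj s x}
  have hentering : enteringEdges G (I, I ∪ W) ⊆ F := by
    rintro ⟨x, y⟩ ⟨hadj, hx, hyW, hy⟩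
    by_contra hF
    have hxW : x ∉ W := fun hxW => hx (Or.inr hxW)
    have hsx : ReflTransGen (residualDigraph G F W).Adj s x :=
      not_not.1 fun hsx => hx (Or.inl ⟨hxW, hsx⟩)
    exact hy (hsx.tail ⟨hadj, hF, hxW, hyW⟩)
  have hwall : (I ∪ W) \ I ⊆ W := fun x hx => hx.1.resolve_left hx.2
  have hB : IsRootBiset s T (I, I ∪ W) :=
    { inner_subset_outer := Set.subset_union_left
      inner_nonempty := ⟨v, hvW, hv⟩
      root_notMem_outer := fun hs => hs.elim (fun hsI => hsI.2 .refl) hsW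
      wall_subset := hwall.trans hWT }
  have hdegree : bisetDegree G (I, I ∪ W) ≤ F.ncard + W.ncard :=
    Nat.add_le_add (Set.ncard_le_ncard hentering) (Set.ncard_le_ncard hwall)
  exact (h _ hB).not_gt (hdegree.trans_lt hFW)

end Bisets

section Sparsification

variable [Finite V] {B C : Set V × Set V}

theorem RootConnected.bisetDegree_inf_le (h : RootConnected k s T G) (hB : IsRootBiset s T B)
    (hC : IsRootBiset s T C) (hBk : bisetDegree G B ≤ k) (hCk : bisetDegree G C ≤ k) :
    bisetDegree G (B ⊓ C) ≤ k := by
  have hsubmodular := bisetDegree_submodular G B C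
  have hsup := h.le_bisetDegree (hB.sup hC)
  omega

theorem exists_tight_biset_of_minimal (h : Minimal (RootConnected k s T) G) {e : V × V}
    (he : e ∈ G.edgeSet) :
    ∃ B, IsRootBiset s T B ∧ bisetDegree G B ≤ k ∧ e ∈ enteringEdges G B := by
  have hdelete : ¬ RootConnected k s T (G.deleteEdge e) := fun hconn =>
    not_le_deleteEdge he (h.le_of_le hconn (deleteEdge_le G e))
  obtain ⟨B, hB, hlt⟩ : ∃ B, IsRootBiset s T B ∧ bisetDegree (G.deleteEdge e) B < k := by
    by_contra! hle
    exact hdelete (rootConnected_of_forall_le_bisetDegree hle)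
  have hle : k ≤ bisetDegree G B := h.prop.le_bisetDegree hB
  rw [bisetDegree, enteringEdges_deleteEdge] at hlt
  have heB : e ∈ enteringEdges G B := by
    by_contra heB
    rw [Set.sdiff_singleton_eq_self heB] at hlt
    exact hle.not_gt hlt
  refine ⟨B, hB, ?_, heB⟩
  have hcard := Set.ncard_sdiff_singleton_add_one heB
  unfold bisetDegree
  omega

theorem ncard_inEdges_le_of_minimal (h : Minimal (RootConnected k s T) G) (v : V) :
    {e ∈ G.edgeSet | e.2 = v}.ncard ≤ k := by
  rcases Set.eq_empty_or_nonempty {e ∈ G.edgeSet | e.2 = v} with hempty | ⟨e₀, he₀, rfl⟩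
  · simp [hempty]
  let tight : Set (Set V × Set V) := {B | IsRootBiset s T B ∧ bisetDegree G B ≤ k ∧ e₀.2 ∈ B.1}
  have htight : tight.Nonempty := by
    obtain ⟨B, hB, hBk, -, -, hv⟩ := exists_tight_biset_of_minimal h he₀
    exact ⟨B, hB, hBk, hv⟩
  obtain ⟨B, ⟨hB, hBk, hvB⟩, hmin⟩ := tight.toFinite.exists_minimal htight
  have hsubset : {e ∈ G.edgeSet | e.2 = e₀.2} ⊆ enteringEdges G B := by
    rintro e ⟨he, hev⟩
    obtain ⟨C, hC, hCk, -, heO, heI⟩ := exists_tight_biset_of_minimal h he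
    rw [hev] at heI
    have hinf : B ⊓ C ∈ tight :=
      ⟨hB.inf hC ⟨e₀.2, hvB, heI⟩, h.prop.bisetDegree_inf_le hB hC hBk hCk, hvB, heI⟩
    have hBC : B ≤ C := (hmin hinf inf_le_left).trans inf_le_right
    exact ⟨he, fun heB => heO (hBC.2 heB), hev ▸ hvB⟩
  calc {e ∈ G.edgeSet | e.2 = e₀.2}.ncard
      ≤ (enteringEdges G B).ncard := Set.ncard_le_ncard hsubset
    _ ≤ bisetDegree G B := Nat.le_add_right _ _
    _ ≤ k := hBk

theorem ncard_edgeSet_le_of_forall_ncard_inEdges_le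
    (h : ∀ v, {e ∈ G.edgeSet | e.2 = v}.ncard ≤ k) : G.edgeSet.ncard ≤ k * Nat.card V := by
  have := Fintype.ofFinite V
  calc G.edgeSet.ncard
      = (⋃ v, {e ∈ G.edgeSet | e.2 = v}).ncard := by
        congr 1
        ext e
        simp
    _ ≤ ∑ v, {e ∈ G.edgeSet | e.2 = v}.ncard := Set.ncard_iUnion_le_of_fintype _
    _ ≤ ∑ _v : V, k := Finset.sum_le_sum fun v _ => h v
    _ = k * Nat.card V := by simp [mul_comm]

theorem RootConnected.exists_le_ncard_edgeSet_le (h : RootConnected k s T G) :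
    ∃ H ≤ G, RootConnected k s T H ∧ H.edgeSet.ncard ≤ k * Nat.card V := by
  have : Finite (Digraph V) := Finite.of_injective _ Digraph.adj_injective
  obtain ⟨H, hHG, hH⟩ := exists_minimal_le_of_wellFoundedLT (RootConnected k s T) G h
  exact ⟨H, hHG, hH.prop,
    ncard_edgeSet_le_of_forall_ncard_inEdges_le (ncard_inEdges_le_of_minimal hH)⟩

theorem exists_le_forall_rootConnected (hs : s ∉ T) (h : ∀ u, RootConnected k u T G) :
    ∃ H ≤ G, (∀ u, RootConnected k u T H) ∧ H.edgeSet.ncard ≤ 2 * k * Nat.card V := by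
  obtain ⟨hout, hin⟩ := (forall_rootConnected_iff hs).1 h
  obtain ⟨H₁, hle₁, hH₁, hcard₁⟩ := hout.exists_le_ncard_edgeSet_le
  obtain ⟨H₂, hle₂, hH₂, hcard₂⟩ := hin.exists_le_ncard_edgeSet_le
  refine ⟨H₁ ⊔ reverseDigraph H₂, sup_le hle₁ (reverseDigraph_le_iff.2 hle₂),
    (forall_rootConnected_iff hs).2
      ⟨hH₁.mono le_sup_left, hH₂.mono (reverseDigraph_le_iff.1 le_sup_right)⟩, ?_⟩
  calc (H₁ ⊔ reverseDigraph H₂).edgeSet.ncard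
      ≤ H₁.edgeSet.ncard + (reverseDigraph H₂).edgeSet.ncard := ncard_edgeSet_sup_le _ _
    _ ≤ k * Nat.card V + k * Nat.card V := by
        rw [ncard_edgeSet_reverseDigraph]
        exact Nat.add_le_add hcard₁ hcard₂
    _ = 2 * k * Nat.card V := by ring

end Sparsification

section TwoTConnected

theorem twoEdgeConnected_iff_forall_deleteEdge :
    G.TwoEdgeConnected ↔ ∀ e, (G.deleteEdge e).StronglyConnected := by
  constructor
  · intro h e
    by_cases he : e ∈ G.edgeSet
    · exact not_not.1 fun hbridge => h.2 e he ⟨he, hbridge⟩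
    · have hle : G ≤ G.deleteEdge e := fun a b hab => ⟨hab, fun habe => he (habe ▸ hab)⟩
      exact fun u v => reflTransGen_adj_mono hle (h.1 u v)
  · exact fun h => ⟨fun u v => reflTransGen_adj_mono (deleteEdge_le G (u, u)) (h (u, u) u v),
      fun e _ hbridge => hbridge.2 (h e)⟩

theorem reflTransGen_deleteVertex_iff {w : V} (u v : {v : V // v ≠ w}) :
    ReflTransGen (G.deleteVertex w).Adj u v ↔ ReflTransGen (residualDigraph G ∅ {w}).Adj u v := by
  constructor
  · exact fun h => h.lift Subtype.val fun a b hab => ⟨hab, not_false, a.2, b.2⟩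
  · obtain ⟨v, hv⟩ := v
    intro h
    change ReflTransGen _ u.1 v at h
    induction h with
    | refl => exact .refl
    | tail _ hbc ih => exact (ih hbc.2.2.1).tail hbc.1

theorem twoTConnected_iff_forall_rootConnected [Finite V] :
    G.TwoTConnected T ↔ ∀ u, RootConnected 2 u T G := by
  rw [Digraph.TwoTConnected, twoEdgeConnected_iff_forall_deleteEdge]
  constructor
  · rintro ⟨hedge, hvertex⟩ u F W hWT hu hFW v hv
    rcases W.eq_empty_or_nonempty with rfl | ⟨w, hw⟩
    · have : Nonempty (V × V) := ⟨(u, u)⟩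
      obtain ⟨e, he⟩ := (Set.ncard_le_one_iff_subset_singleton).1 (show F.ncard ≤ 1 by omega)
      have hle : G.deleteEdge e ≤ residualDigraph G F ∅ :=
        fun a b hab => ⟨hab.1, fun hF => hab.2 (he hF), not_false, not_false⟩
      exact reflTransGen_adj_mono hle (hedge e u v)
    · have hWpos : 0 < W.ncard := (Set.ncard_pos).2 ⟨w, hw⟩
      obtain rfl : F = ∅ := (Set.ncard_eq_zero).1 (by omega)
      obtain ⟨w, rfl⟩ := Set.ncard_eq_one.1 (show W.ncard = 1 by omega)
      exact (reflTransGen_deleteVertex_iff ⟨u, hu⟩ ⟨v, hv⟩).1 (not_not.1 (hvertex w (hWT rfl)) _ _)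
  · refine fun h => ⟨fun e u v => ?_, fun w hw => not_not.2 fun u v => ?_⟩
    · have hle : residualDigraph G {e} ∅ ≤ G.deleteEdge e := fun a b hab => ⟨hab.1, hab.2.1⟩
      exact reflTransGen_adj_mono hle
        (h u {e} ∅ (Set.empty_subset T) not_false (by simp) v not_false)
    · exact (reflTransGen_deleteVertex_iff u v).2
        (h u ∅ {w} (Set.singleton_subset_iff.2 hw) u.2 (by simp) v v.2)

theorem twoTConnected_mono (h : H.TwoTConnected T) (hHG : H ≤ G) : G.TwoTConnected T := by
  rw [Digraph.TwoTConnected, twoEdgeConnected_iff_forall_deleteEdge] at h ⊢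
  obtain ⟨hedge, hvertex⟩ := h
  refine ⟨fun e u v => ?_, fun w hw => not_not.2 fun u v => ?_⟩
  · have hle : H.deleteEdge e ≤ G.deleteEdge e := fun _ _ hab => ⟨hHG hab.1, hab.2⟩
    exact reflTransGen_adj_mono hle (hedge e u v)
  · have hle : H.deleteVertex w ≤ G.deleteVertex w := fun _ _ hab => hHG hab
    exact reflTransGen_adj_mono hle (not_not.1 (hvertex w hw) u v)

theorem twoTConnected_union_iff {S : Set V} :
    G.TwoTConnected (S ∪ T) ↔ G.TwoTConnected S ∧ G.TwoTConnected T := by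
  simp only [Digraph.TwoTConnected, Set.mem_union, or_imp, forall_and]
  tauto

theorem exists_le_twoTConnected_of_notMem [Finite V] (hs : s ∉ T) (h : G.TwoTConnected T) :
    ∃ H ≤ G, H.TwoTConnected T ∧ H.edgeSet.ncard ≤ 4 * Nat.card V := by
  simp only [twoTConnected_iff_forall_rootConnected] at h ⊢
  exact exists_le_forall_rootConnected hs h

theorem exists_le_twoTConnected [Finite V] [Nontrivial V] (h : G.TwoTConnected T) :
    ∃ H ≤ G, H.TwoTConnected T ∧ H.edgeSet.ncard ≤ 8 * Nat.card V := by
  obtain ⟨s, r, hsr⟩ := exists_pair_ne V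
  have hT : T \ {s} ∪ T \ {r} = T := by
    rw [← Set.sdiff_inter, Set.singleton_inter_eq_empty.2 (by simpa using hsr), Set.sdiff_empty]
  rw [← hT, twoTConnected_union_iff] at h
  obtain ⟨H₁, hle₁, hH₁, hcard₁⟩ := exists_le_twoTConnected_of_notMem (s := s) (by simp) h.1
  obtain ⟨H₂, hle₂, hH₂, hcard₂⟩ := exists_le_twoTConnected_of_notMem (s := r) (by simp) h.2
  have hH : (H₁ ⊔ H₂).TwoTConnected T := hT ▸ twoTConnected_union_iff.2
    ⟨twoTConnected_mono hH₁ le_sup_left, twoTConnected_mono hH₂ le_sup_right⟩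
  have hcard := ncard_edgeSet_sup_le H₁ H₂
  exact ⟨H₁ ⊔ H₂, sup_le hle₁ hle₂, hH, by omega⟩

theorem eq_of_minimalTwoTConnected_of_le (hG : G.MinimalTwoTConnected T) (hHG : H ≤ G)
    (hH : H.TwoTConnected T) : H = G := by
  refine hHG.antisymm fun u v huv => ?_
  by_contra hn
  refine hG.2 (u, v) huv (twoTConnected_mono hH fun a b hab => ⟨hHG hab, ?_⟩)
  rintro ⟨⟩
  exact hn hab

theorem ncard_edgeSet_le_card_of_subsingleton [Subsingleton V] (G : Digraph V) :
    G.edgeSet.ncard ≤ Nat.card V :=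
  calc G.edgeSet.ncard
      ≤ Nat.card (V × V) := Set.ncard_le_card _
    _ = Nat.card V * Nat.card V := Nat.card_prod V V
    _ ≤ 1 * Nat.card V := Nat.mul_le_mul_right _ (Finite.card_le_one_iff_subsingleton.2 ‹_›)
    _ = Nat.card V := one_mul _

end TwoTConnected

end

theorem mainTheorem3 {V : Type*} [Fintype V] (G : Digraph V) (T : Set V)
    (hG : G.MinimalTwoTConnected T) :
    G.edgeSet.ncard ≤ 8 * Fintype.card V := by
  rw [← Nat.card_eq_fintype_card]
  rcases subsingleton_or_nontrivial V with hV | hV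
  · exact (ncard_edgeSet_le_card_of_subsingleton G).trans (Nat.le_mul_of_pos_left _ (by norm_num))
  · obtain ⟨H, hHG, hH, hcard⟩ := exists_le_twoTConnected hG.1
    rwa [eq_of_minimalTwoTConnected_of_le hG hHG hH] at hcard
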